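/- Let $K$ be a field, $n\ge 0$, $S=K[x_1,\dots,x_n]$ with the standard grading, and let $J=(f_1,\dots,f_n)\subset S$ be a graded complete intersection, that is, $f_1,\dots,f_n$ are homogeneous polynomials forming a regular sequence on $S$, with $\deg f_i\ge 2$ for all $1\le i\le n$. Let $h=h_{S/J}:\mathbb Z\to\mathbb Z_{\ge 0}$, $h(k)=\dim_K (S/J)_k$, be the Hilbert function of $S/J$, and let $k_0=\min\{k : h(k)\ne 0\}$. For integers $d,k$ put $$\beta_k^d(h)=\sum_{j=k_0}^{k}(-1)^{k-j}\binom{d-j}{k-j}h(j)\quad\text{if } k_0\le k\le d,\qquad \beta_k^d(h)=0\quad\text{otherwise.}$$ Then the Hilbert depth of $h$ equals $n$: $$\operatorname{qdepth}(h_{S/J}):=\max\{d\in\mathbb Z : \beta_k^d(h)\ge 0\ \text{for all } k\le d\}=n.$$ -/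

import Mathlib

/-- A family `f 0, …, f (r - 1)` of polynomials in `S = K[x_1, …, x_n]` presents the ideal `J` as a
graded complete intersection of type `(deg 0, …, deg (r - 1))`: the `f i` are homogeneous of degree
`deg i`, they generate `J`, and they form a regular sequence on `S` (in particular `J ≠ S`). -/
structure IsGradedCompleteIntersection {K : Type*} [Field K] {n r : ℕ}
    (J : Ideal (MvPolynomial (Fin n) K)) (f : Fin r → MvPolynomial (Fin n) K)
    (deg : Fin r → ℕ) : Prop where
  homogeneous : ∀ i, (f i).IsHomogeneous (deg i)
  generates : J = Ideal.span (Set.range f)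
  regular : RingTheory.Sequence.IsRegular (MvPolynomial (Fin n) K) (List.ofFn f)

/-- The component `(S/J)_k`, `k ∈ ℤ`, of `S/J` for a homogeneous ideal `J` of
`S = K[x_1, …, x_n]`: the classes of the homogeneous polynomials of degree `k` if `k ≥ 0`, and
zero if `k < 0`. -/
noncomputable def quotientPiece {K : Type*} [Field K] {n : ℕ}
    (J : Ideal (MvPolynomial (Fin n) K)) : ℤ → Submodule K (MvPolynomial (Fin n) K ⧸ J)
  | Int.ofNat m =>
      (MvPolynomial.homogeneousSubmodule (Fin n) K m).map (Ideal.Quotient.mkₐ K J).toLinearMap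
  | Int.negSucc _ => ⊥

/-- The Hilbert function `h_{S/J} : ℤ → ℤ_{≥ 0}`, `k ↦ dim_K (S/J)_k`. The components are
finite-dimensional, so `finrank` is the dimension. -/
noncomputable def hilbertFunction {K : Type*} [Field K] {n : ℕ}
    (J : Ideal (MvPolynomial (Fin n) K)) (k : ℤ) : ℕ :=
  Module.finrank K (quotientPiece J k)

/-- `k₀(h) = min {k : h k ≠ 0}`, for a nonzero `h : ℤ → ℤ_{≥ 0}` that vanishes far to the left. -/
noncomputable def initialDegree (h : ℤ → ℕ) : ℤ := sInf {k : ℤ | h k ≠ 0}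

/-- `β_k^d(h) = ∑_{j = k₀}^{k} (-1)^(k - j) * binom (d - j) (k - j) * h j` if `k₀ ≤ k ≤ d`, and
`0` otherwise. In each summand `0 ≤ k - j ≤ d - j`, so that `Int.toNat` truncates nothing. -/
noncomputable def hilbertBeta (h : ℤ → ℕ) (d k : ℤ) : ℤ :=
  if initialDegree h ≤ k ∧ k ≤ d then
    ∑ j ∈ Finset.Icc (initialDegree h) k,
      (-1) ^ (k - j).toNat * ((d - j).toNat.choose (k - j).toNat : ℤ) * (h j : ℤ)
  else 0

/-- `IsHilbertDepth h q` says that the Hilbert depth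
`max {d ∈ ℤ : β_k^d(h) ≥ 0 for all k ≤ d}` of `h` exists and equals `q`. -/
def IsHilbertDepth (h : ℤ → ℕ) (q : ℤ) : Prop :=
  IsGreatest {d : ℤ | ∀ k ≤ d, 0 ≤ hilbertBeta h d k} q

/-! For `k₀ = 0`, `β_k^d(h)` is the coefficient of `X ^ k` in `H / (1 + X) ^ (d - k + 1)`, where `H`
is the generating series of `h` (`hilbertBeta_natCast`). For a complete intersection with `n`
generators in `n` variables, `H` is the product of the sums `1 + X + ... + X ^ (deg i - 1)`. Lower
bound: each such factor has at least two terms, hence raises the depth bound by one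
(`mul_geom_sum`), starting from depth 0 for `H = 1`. Upper bound: `h 0 = 1` and `h 1 = n`, so `β_1^d
= n - d` is negative for `d > n`. -/

/-! ### Power series and sign conditions. -/

open PowerSeries in
/-- The power series `1 / (1 + X)` over `ℤ`. -/
noncomputable def invOneAddX : PowerSeries ℤ := rescale (-1) (mk 1)

open PowerSeries in
lemma one_add_X_mul_invOneAddX : (1 + X) * invOneAddX = 1 := by
  have h := congrArg (rescale (-1 : ℤ)) (mk_one_mul_one_sub_eq_one ℤ)
  rw [map_mul, map_sub, map_one, rescale_X] at h
  rw [invOneAddX, mul_comm]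
  simpa [sub_neg_eq_add] using h

open PowerSeries in
lemma coeff_invOneAddX_pow_succ (a m : ℕ) :
    coeff m (invOneAddX ^ (a + 1)) = (-1) ^ m * ((a + m).choose m : ℤ) := by
  rw [invOneAddX, ← map_pow, mk_one_pow_eq_mk_choose_add, coeff_rescale, coeff_mk,
    Nat.choose_symm_add]

open PowerSeries in
/-- All coefficients of degree `k` of `H / (1 + X) ^ a`, where `a + k ≤ d + 1`, are nonnegative:
for the generating series of a Hilbert function this says that its Hilbert depth is at
least `d` (and that its first values are nonnegative). -/
def HilbertDepthAtLeast (d : ℕ) (H : PowerSeries ℤ) : Prop :=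
  ∀ a k, a + k ≤ d + 1 → 0 ≤ coeff k (H * invOneAddX ^ a)

namespace HilbertDepthAtLeast

open PowerSeries

variable {d e : ℕ} {H G : PowerSeries ℤ}

lemma mono (h : HilbertDepthAtLeast d H) (hed : e ≤ d) : HilbertDepthAtLeast e H :=
  fun a k hak => h a k (by omega)

lemma zero : HilbertDepthAtLeast d 0 := fun a k _ => by simp

lemma add (hH : HilbertDepthAtLeast d H) (hG : HilbertDepthAtLeast d G) :
    HilbertDepthAtLeast d (H + G) := fun a k hak => by
  rw [add_mul, map_add]
  exact add_nonneg (hH a k hak) (hG a k hak)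

lemma one : HilbertDepthAtLeast 0 1 := fun a k hak => by
  rcases a with _ | a
  · rw [pow_zero, mul_one, coeff_one]
    split_ifs <;> simp
  · obtain rfl : k = 0 := by omega
    rw [one_mul, coeff_invOneAddX_pow_succ]
    simp

lemma mul_X_pow (h : HilbertDepthAtLeast d H) (s : ℕ) :
    HilbertDepthAtLeast (d + s) (H * X ^ s) := fun a k hak => by
  rw [mul_right_comm, coeff_mul_X_pow']
  split_ifs with hs
  · exact h a (k - s) (by omega)
  · rfl

/-- The new factor cancels one inverse power of `1 + X`. For `a = 0` nothing cancels and `k` may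
reach `d + 2`, beyond the range of `h`; this is why `h0` is needed. -/
lemma mul_one_add_X (h : HilbertDepthAtLeast d H) (h0 : ∀ k, 0 ≤ coeff k H) :
    HilbertDepthAtLeast (d + 1) (H * (1 + X)) := fun a k hak => by
  rcases a with _ | a
  · rw [pow_zero, mul_one, mul_add, mul_one, map_add]
    refine add_nonneg (h0 k) ?_
    rcases k with _ | k
    · simp
    · rw [coeff_succ_mul_X]
      exact h0 k
  · have e : H * (1 + X) * invOneAddX ^ (a + 1) = H * invOneAddX ^ a := by
      rw [pow_succ', mul_assoc, ← mul_assoc (1 + X), one_add_X_mul_invOneAddX, one_mul]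
    rw [e]
    exact h a k (by omega)

/-- Splits the sum as `(1 + X) + X ^ 2 * (sum of m terms)`: the first part gains one by
cancellation, the second gains two by the shift. So the shorter sum only has to keep depth `d`,
which also holds for the base cases 0 and `H`. -/
lemma mul_geom_sum (h : HilbertDepthAtLeast d H) (h0 : ∀ k, 0 ≤ coeff k H) (m : ℕ) :
    HilbertDepthAtLeast (d + 1) (H * ∑ i ∈ Finset.range (m + 2), X ^ i) := by
  have key (m : ℕ) (hm : HilbertDepthAtLeast d (H * ∑ i ∈ Finset.range m, X ^ i)) :
      HilbertDepthAtLeast (d + 1) (H * ∑ i ∈ Finset.range (m + 2), X ^ i) := by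
    have e : H * ∑ i ∈ Finset.range (m + 2), X ^ i =
        H * (∑ i ∈ Finset.range m, X ^ i) * X ^ 2 + H * (1 + X) := by
      rw [add_comm m 2, Finset.sum_range_add, mul_assoc, Finset.sum_mul, Finset.sum_range_succ,
        Finset.sum_range_one]
      simp only [pow_add, pow_zero, pow_one, mul_comm (X ^ 2 : PowerSeries ℤ)]
      ring
    rw [e]
    exact ((hm.mul_X_pow 2).mono (by omega)).add (h.mul_one_add_X h0)
  refine key m ?_
  induction m using Nat.twoStepInduction with
  | zero => simpa using zero
  | one => simpa using h
  | more m ih _ => exact (key m ih).mono (Nat.le_succ d)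

end HilbertDepthAtLeast

open PowerSeries in
lemma coeff_prod_geom_sum_nonneg {ι : Type*} (s : Finset ι) (deg : ι → ℕ) (k : ℕ) :
    0 ≤ coeff k (∏ i ∈ s, ∑ j ∈ Finset.range (deg i), (X : PowerSeries ℤ) ^ j) := by
  classical
  rw [coeff_prod]
  refine Finset.sum_nonneg fun l _ => Finset.prod_nonneg fun i _ => ?_
  rw [map_sum]
  refine Finset.sum_nonneg fun j _ => ?_
  rw [coeff_X_pow]
  split_ifs <;> simp

open PowerSeries in
lemma HilbertDepthAtLeast.prod_geom_sum {ι : Type*} (s : Finset ι) (deg : ι → ℕ)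
    (hdeg : ∀ i, 2 ≤ deg i) :
    HilbertDepthAtLeast s.card (∏ i ∈ s, ∑ j ∈ Finset.range (deg i), X ^ j) := by
  classical
  induction s using Finset.induction_on with
  | empty => simpa using HilbertDepthAtLeast.one
  | insert a s ha ih =>
    rw [Finset.prod_insert ha, Finset.card_insert_of_notMem ha, mul_comm]
    obtain ⟨m, hm⟩ := Nat.exists_eq_add_of_le' (hdeg a)
    rw [hm]
    exact ih.mul_geom_sum (coeff_prod_geom_sum_nonneg s deg) m

open PowerSeries in
lemma coeff_zero_one_prod_geom_sum {ι : Type*} (s : Finset ι) (deg : ι → ℕ)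
    (hdeg : ∀ i, 2 ≤ deg i) :
    coeff 0 (∏ i ∈ s, ∑ j ∈ Finset.range (deg i), (X : PowerSeries ℤ) ^ j) = 1 ∧
      coeff 1 (∏ i ∈ s, ∑ j ∈ Finset.range (deg i), (X : PowerSeries ℤ) ^ j) = s.card := by
  classical
  induction s using Finset.induction_on with
  | empty => simp [coeff_one]
  | insert a s ha ih =>
    have h (k : ℕ) (hk : k < 2) :
        coeff k (∑ j ∈ Finset.range (deg a), (X : PowerSeries ℤ) ^ j) = 1 := by
      simp only [map_sum, coeff_X_pow]
      rw [Finset.sum_ite_eq, if_pos]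
      exact Finset.mem_range.2 (hk.trans_le (hdeg a))
    rw [Finset.prod_insert ha, Finset.card_insert_of_notMem ha]
    constructor
    · rw [coeff_mul, Finset.Nat.antidiagonal_zero, Finset.sum_singleton]
      rw [h 0 (by norm_num), ih.1, one_mul]
    · rw [coeff_mul, Finset.Nat.sum_antidiagonal_eq_sum_range_succ_mk, Finset.sum_range_succ,
        Finset.sum_range_one]
      simp only [Nat.sub_zero, Nat.sub_self]
      rw [h 0 (by norm_num), h 1 (by norm_num), ih.1, ih.2]
      push_cast
      ring

/-- The generating series of the Hilbert function of `S/I` in nonnegative degrees. -/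
noncomputable def hilbertSeries {K : Type*} [Field K] {n : ℕ}
    (I : Ideal (MvPolynomial (Fin n) K)) : PowerSeries ℤ :=
  PowerSeries.mk fun k => (hilbertFunction I (k : ℤ) : ℤ)

/-! ### Hilbert series of graded complete intersections. -/

section HilbertSeries

open MvPolynomial

variable {K : Type*} [Field K] {n : ℕ}

lemma hilbertFunction_natCast (I : Ideal (MvPolynomial (Fin n) K)) (k : ℕ) :
    hilbertFunction I (k : ℤ) =
      Module.finrank K
        ((homogeneousSubmodule (Fin n) K k).map (Ideal.Quotient.mkₐ K I).toLinearMap) :=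
  rfl

lemma hilbertFunction_of_neg (I : Ideal (MvPolynomial (Fin n) K)) {k : ℤ} (hk : k < 0) :
    hilbertFunction I k = 0 := by
  obtain ⟨m, rfl⟩ := Int.eq_negSucc_of_lt_zero hk
  exact finrank_bot K _

lemma finrank_homogeneousSubmodule (k : ℕ) :
    Module.finrank K (homogeneousSubmodule (Fin n) K k) =
      ((Finset.univ : Finset (Fin n)).finsuppAntidiag k).card := by
  have hspan : homogeneousSubmodule (Fin n) K k =
      Submodule.span K (Set.range fun d : (Finset.univ : Finset (Fin n)).finsuppAntidiag k =>
        basisMonomials (Fin n) K d) := by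
    apply le_antisymm
    · intro p hp
      rw [p.as_sum]
      refine Submodule.sum_mem _ fun d hd => ?_
      have : (monomial d (coeff d p) : MvPolynomial (Fin n) K) =
          coeff d p • basisMonomials (Fin n) K d := by
        simp [smul_monomial]
      rw [this]
      refine Submodule.smul_mem _ _ (Submodule.subset_span ⟨⟨d, ?_⟩, rfl⟩)
      have := hp (mem_support_iff.1 hd)
      simpa [Finsupp.weight_apply, Finsupp.sum_fintype] using this
    · rw [Submodule.span_le]
      rintro _ ⟨⟨d, hd⟩, rfl⟩
      simp only [coe_basisMonomials]
      refine isHomogeneous_monomial _ ?_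
      simpa [Finsupp.degree_eq_sum] using hd
  rw [hspan, finrank_span_eq_card, Fintype.card_coe]
  exact (basisMonomials (Fin n) K).linearIndependent.comp _ Subtype.val_injective

lemma hilbertSeries_bot :
    hilbertSeries (⊥ : Ideal (MvPolynomial (Fin n) K)) = PowerSeries.mk 1 ^ n := by
  ext k
  have hinj : Function.Injective
      (Ideal.Quotient.mkₐ K (⊥ : Ideal (MvPolynomial (Fin n) K))).toLinearMap := by
    intro x y hxy
    simpa [sub_eq_zero] using Ideal.Quotient.eq.1 hxy
  rw [hilbertSeries, PowerSeries.coeff_mk, hilbertFunction_natCast,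
    ← (Submodule.equivMapOfInjective _ hinj _).finrank_eq, finrank_homogeneousSubmodule]
  have := PowerSeries.coeff_prod (fun _ : Fin n => (PowerSeries.mk 1 : PowerSeries ℤ)) k
    Finset.univ
  rw [Finset.prod_const, Finset.card_univ, Fintype.card_fin] at this
  rw [this]
  simp

instance (k : ℕ) : Module.Finite K (homogeneousSubmodule (Fin n) K k) :=
  Module.Finite.iff_fg.2 (homogeneousSubmodule_fg _ _ k)

lemma homogeneousComponent_mul_of_left {f : MvPolynomial (Fin n) K} {d : ℕ}
    (hf : f.IsHomogeneous d) (k : ℕ) (s : MvPolynomial (Fin n) K) :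
    homogeneousComponent k (f * s) =
      if d ≤ k then f * homogeneousComponent (k - d) s else 0 := by
  let _ : GradedAlgebra (homogeneousSubmodule (Fin n) K) := gradedAlgebra
  have h := DirectSum.coe_decompose_mul_of_left_mem (homogeneousSubmodule (Fin n) K) k
    (b := s) ((mem_homogeneousSubmodule d f).2 hf)
  have e (i : ℕ) (p : MvPolynomial (Fin n) K) :
      (DirectSum.decompose (homogeneousSubmodule (Fin n) K) p i : MvPolynomial (Fin n) K) =
        homogeneousComponent i p := decomposition.decompose'_apply p i
  rwa [e, e] at h

lemma homogeneousComponent_mem_sup_span_singleton {I : Ideal (MvPolynomial (Fin n) K)}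
    (hI : ∀ p ∈ I, ∀ k, homogeneousComponent k p ∈ I) {f : MvPolynomial (Fin n) K} {d : ℕ}
    (hf : f.IsHomogeneous d) :
    ∀ p ∈ I ⊔ Ideal.span {f}, ∀ k, homogeneousComponent k p ∈ I ⊔ Ideal.span {f} := by
  intro p hp k
  obtain ⟨i, hi, j, hj, rfl⟩ := Submodule.mem_sup.1 hp
  obtain ⟨s, rfl⟩ := Ideal.mem_span_singleton.1 hj
  rw [map_add, homogeneousComponent_mul_of_left hf]
  refine add_mem (Ideal.mem_sup_left (hI i hi k)) (Ideal.mem_sup_right ?_)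
  split_ifs
  · exact Ideal.mem_span_singleton.2 (dvd_mul_right _ _)
  · exact zero_mem _

/-- Exactness in degree `k` of multiplication by `f` followed by the projection: taking the degree
`k` component of `g = i + f * s` makes `s` homogeneous of degree `k - d`. -/
lemma map_homogeneousSubmodule_inf_ker_factor {I : Ideal (MvPolynomial (Fin n) K)}
    (hI : ∀ p ∈ I, ∀ k, homogeneousComponent k p ∈ I) {f : MvPolynomial (Fin n) K} {d : ℕ}
    (hf : f.IsHomogeneous d) (k : ℕ) :
    (homogeneousSubmodule (Fin n) K k).map (Ideal.Quotient.mkₐ K I).toLinearMap ⊓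
        LinearMap.ker (Ideal.Quotient.factorₐ K
          (le_sup_left : I ≤ I ⊔ Ideal.span {f})).toLinearMap =
      if d ≤ k then
        ((homogeneousSubmodule (Fin n) K (k - d)).map (Ideal.Quotient.mkₐ K I).toLinearMap).map
          (LinearMap.mulLeft K (Ideal.Quotient.mk I f))
      else ⊥ := by
  apply le_antisymm
  · rintro _ ⟨⟨g, hg, rfl⟩, hker⟩
    have hgI : g ∈ I ⊔ Ideal.span {f} := Ideal.Quotient.eq_zero_iff_mem.1 hker
    obtain ⟨i, hi, j, hj, hij⟩ := Submodule.mem_sup.1 hgI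
    obtain ⟨s, rfl⟩ := Ideal.mem_span_singleton.1 hj
    have hg' := homogeneousComponent_eq_self ((mem_homogeneousSubmodule _ _).1 hg)
    rw [← hij, map_add, homogeneousComponent_mul_of_left hf, hij] at hg'
    have hik := Ideal.Quotient.eq_zero_iff_mem.2 (hI i hi k)
    split_ifs with hdk
    · rw [if_pos hdk] at hg'
      refine ⟨_, ⟨homogeneousComponent (k - d) s, homogeneousComponent_mem _ _, rfl⟩, ?_⟩
      change Ideal.Quotient.mk I f * Ideal.Quotient.mk I _ = Ideal.Quotient.mk I g
      rw [← hg', map_add, hik, zero_add, map_mul]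
    · rw [if_neg hdk, add_zero] at hg'
      change Ideal.Quotient.mk I g = 0
      rw [← hg', hik]
  · split_ifs with hdk
    · rintro _ ⟨_, ⟨s, hs, rfl⟩, rfl⟩
      refine ⟨⟨f * s, ?_, map_mul (Ideal.Quotient.mk I) f s⟩, ?_⟩
      · have := hf.mul ((mem_homogeneousSubmodule _ _).1 hs)
        rwa [Nat.add_sub_cancel' hdk] at this
      · change Ideal.Quotient.mk (I ⊔ Ideal.span {f}) (f * s) = 0
        exact Ideal.Quotient.eq_zero_iff_mem.2
          (Ideal.mem_sup_right (Ideal.mem_span_singleton.2 (dvd_mul_right _ _)))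
    · exact bot_le

/-- Rank-nullity in each degree of `0 → (S/I)(-d) → S/I → S/(I + (f)) → 0`. -/
lemma hilbertSeries_sup_span_singleton {I : Ideal (MvPolynomial (Fin n) K)}
    (hI : ∀ p ∈ I, ∀ k, homogeneousComponent k p ∈ I) {f : MvPolynomial (Fin n) K} {d : ℕ}
    (hf : f.IsHomogeneous d) (hreg : ∀ g, f * g ∈ I → g ∈ I) :
    hilbertSeries (I ⊔ Ideal.span {f}) = hilbertSeries I * (1 - PowerSeries.X ^ d) := by
  ext k
  have hinj : Function.Injective (LinearMap.mulLeft K (Ideal.Quotient.mk I f)) := by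
    rw [injective_iff_map_eq_zero]
    intro x hx
    obtain ⟨g, rfl⟩ := Ideal.Quotient.mk_surjective x
    rw [LinearMap.mulLeft_apply, ← map_mul, Ideal.Quotient.eq_zero_iff_mem] at hx
    exact Ideal.Quotient.eq_zero_iff_mem.2 (hreg g hx)
  let π := (Ideal.Quotient.factorₐ K (le_sup_left : I ≤ I ⊔ Ideal.span {f})).toLinearMap
  let V := (homogeneousSubmodule (Fin n) K k).map (Ideal.Quotient.mkₐ K I).toLinearMap
  have hrank := (π.domRestrict V).finrank_range_add_finrank_ker
  have hW : V.map π = (homogeneousSubmodule (Fin n) K k).map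
      (Ideal.Quotient.mkₐ K (I ⊔ Ideal.span {f})).toLinearMap :=
    (Submodule.map_comp _ _ _).symm
  rw [LinearMap.range_domRestrict, LinearMap.ker_domRestrict, hW,
    ← Submodule.finrank_map_subtype_eq, Submodule.map_comap_subtype,
    map_homogeneousSubmodule_inf_ker_factor hI hf] at hrank
  rw [mul_sub, mul_one, map_sub, PowerSeries.coeff_mul_X_pow', eq_sub_iff_add_eq]
  simp only [hilbertSeries, PowerSeries.coeff_mk, hilbertFunction_natCast]
  split_ifs with hdk
  · rw [if_pos hdk, ← (Submodule.equivMapOfInjective _ hinj _).finrank_eq] at hrank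
    exact_mod_cast hrank
  · rw [if_neg hdk, finrank_bot] at hrank
    exact_mod_cast hrank

lemma ofList_append_singleton {R : Type*} [CommSemiring R] (l : List R) (a : R) :
    Ideal.ofList (l ++ [a]) = Ideal.ofList l ⊔ Ideal.span {a} := by
  rw [Ideal.ofList_append, Ideal.ofList_singleton]

lemma hilbertSeries_ofList_ofFn {r : ℕ} (f : Fin r → MvPolynomial (Fin n) K) (deg : Fin r → ℕ)
    (hf : ∀ i, (f i).IsHomogeneous (deg i))
    (hreg : RingTheory.Sequence.IsWeaklyRegular (MvPolynomial (Fin n) K) (List.ofFn f)) :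
    (∀ p ∈ Ideal.ofList (List.ofFn f), ∀ k,
        homogeneousComponent k p ∈ Ideal.ofList (List.ofFn f)) ∧
      hilbertSeries (Ideal.ofList (List.ofFn f)) =
        PowerSeries.mk 1 ^ n * ∏ i, (1 - PowerSeries.X ^ deg i) := by
  induction r with
  | zero =>
    rw [List.ofFn_zero, Ideal.ofList_nil, hilbertSeries_bot]
    simp +contextual
  | succ r ih =>
    -- The last element is split off, since regularity concerns it modulo the earlier ones.
    rw [List.ofFn_succ', List.concat_eq_append] at hreg ⊢
    obtain ⟨hreg₁, hreg₂⟩ := (RingTheory.Sequence.isWeaklyRegular_append_iff _ _ _).1 hreg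
    obtain ⟨hhom, hser⟩ := ih _ (fun i => deg i.castSucc) (fun i => hf i.castSucc) hreg₁
    rw [RingTheory.Sequence.isWeaklyRegular_singleton_iff] at hreg₂
    rw [ofList_append_singleton]
    refine ⟨homogeneousComponent_mem_sup_span_singleton hhom (hf (Fin.last r)), ?_⟩
    rw [hilbertSeries_sup_span_singleton hhom (hf (Fin.last r)), hser, Fin.prod_univ_castSucc,
      mul_assoc]
    intro g hg
    have hz := hreg₂.right_eq_zero_of_smul (x := Submodule.Quotient.mk g) ?_
    · rw [Submodule.Quotient.mk_eq_zero] at hz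
      simpa using hz
    · rw [← Submodule.Quotient.mk_smul, Submodule.Quotient.mk_eq_zero]
      simpa using hg

lemma IsGradedCompleteIntersection.hilbertSeries_eq {J : Ideal (MvPolynomial (Fin n) K)}
    {f : Fin n → MvPolynomial (Fin n) K} {deg : Fin n → ℕ}
    (hJ : IsGradedCompleteIntersection J f deg) :
    hilbertSeries J = ∏ i, ∑ j ∈ Finset.range (deg i), PowerSeries.X ^ j := by
  have h : J = Ideal.ofList (List.ofFn f) := by
    rw [hJ.generates, Ideal.ofList]
    congr 1
    ext
    simp
  -- As many generators as variables: each `1 - X ^ deg i` gets its own `1 / (1 - X)`.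
  have hpow : (PowerSeries.mk 1 : PowerSeries ℤ) ^ n = ∏ _i : Fin n, PowerSeries.mk 1 := by simp
  rw [h, (hilbertSeries_ofList_ofFn f deg hJ.homogeneous hJ.regular.toIsWeaklyRegular).2, hpow,
    ← Finset.prod_mul_distrib]
  refine Finset.prod_congr rfl fun i _ => ?_
  rw [← mul_neg_geom_sum, ← mul_assoc, PowerSeries.mk_one_mul_one_sub_eq_one, one_mul]

end HilbertSeries

/-! ### The numbers `β_k^d` and the Hilbert depth. -/

lemma hilbertBeta_natCast {h : ℤ → ℕ} (h0 : initialDegree h = 0) {d k : ℕ} (hk : k ≤ d) :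
    hilbertBeta h d k =
      PowerSeries.coeff k
        (PowerSeries.mk (fun j : ℕ => (h j : ℤ)) * invOneAddX ^ (d - k + 1)) := by
  rw [hilbertBeta, h0, if_pos (by omega), PowerSeries.coeff_mul,
    Finset.Nat.sum_antidiagonal_eq_sum_range_succ_mk]
  refine Finset.sum_nbij' Int.toNat (fun j : ℕ => (j : ℤ)) ?_ ?_ ?_ ?_ ?_
  · intro j hj
    rw [Finset.mem_Icc] at hj
    rw [Finset.mem_range]
    omega
  · intro j hj
    rw [Finset.mem_range] at hj
    rw [Finset.mem_Icc]
    omega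
  · intro j hj
    exact Int.toNat_of_nonneg (Finset.mem_Icc.1 hj).1
  · intro j _
    exact Int.toNat_natCast j
  · intro j hj
    rw [Finset.mem_Icc] at hj
    lift j to ℕ using hj.1
    rw [coeff_invOneAddX_pow_succ, PowerSeries.coeff_mk, Int.toNat_natCast,
      show ((k : ℤ) - j).toNat = k - j by omega, show ((d : ℤ) - j).toNat = d - j by omega,
      show d - k + (k - j) = d - j by omega]
    ring

theorem theorem3p1 {K : Type*} [Field K] (n : ℕ) (J : Ideal (MvPolynomial (Fin n) K))
    (f : Fin n → MvPolynomial (Fin n) K) (deg : Fin n → ℕ)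
    (hJ : IsGradedCompleteIntersection J f deg) (hdeg : ∀ i, 2 ≤ deg i) :
    IsHilbertDepth (hilbertFunction J) (n : ℤ) := by
  have hser := hJ.hilbertSeries_eq
  obtain ⟨hc0, hc1⟩ := coeff_zero_one_prod_geom_sum Finset.univ deg hdeg
  have hdepth := HilbertDepthAtLeast.prod_geom_sum Finset.univ deg hdeg
  rw [← hser] at hc0 hc1 hdepth
  rw [Finset.card_univ, Fintype.card_fin] at hc1 hdepth
  have h0 : initialDegree (hilbertFunction J) = 0 := by
    refine IsLeast.csInf_eq ⟨?_, fun k hk => ?_⟩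
    · intro h
      rw [hilbertSeries, PowerSeries.coeff_mk, Nat.cast_zero, h] at hc0
      exact zero_ne_one hc0
    · by_contra! hlt
      exact hk (hilbertFunction_of_neg J hlt)
  constructor
  · intro k hk
    by_cases hk0 : 0 ≤ k
    · lift k to ℕ using hk0
      rw [Nat.cast_le] at hk
      rw [hilbertBeta_natCast h0 hk]
      exact hdepth _ _ (by omega)
    · rw [hilbertBeta, h0, if_neg fun h => hk0 h.1]
  · intro d hd
    by_contra! hlt
    lift d to ℕ using by omega
    -- `d > n ≥ 0` makes `k = 1` admissible.
    have h1 := hd 1 (by omega)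
    have hβ := hilbertBeta_natCast (d := d) (k := 1) h0 (by omega)
    rw [Nat.cast_one] at hβ
    change _ = PowerSeries.coeff 1 (hilbertSeries J * _) at hβ
    rw [hβ, PowerSeries.coeff_mul, Finset.Nat.sum_antidiagonal_eq_sum_range_succ_mk,
      Finset.sum_range_succ, Finset.sum_range_one] at h1
    simp only [Nat.sub_zero, Nat.sub_self, coeff_invOneAddX_pow_succ, hc0, hc1,
      Nat.choose_one_right, Nat.choose_zero_right] at h1
    push_cast at h1
    omega
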